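/- Fix $\sigma>0$. For all $\delta,\xi\in\mathbb{R}$ and $\alpha>0$ let $X=X^{\delta,\alpha,\xi}$ be, under a probability measure $\hat{\mathbb{P}}=\hat{\mathbb{P}}^{\delta,\alpha,\xi}$, a solution of $$dX_t=(\delta-\alpha X_t)\,dt+\sigma\,d\hat{B}_t,\qquad X_0=\xi,$$ driven by a $\hat{\mathbb{P}}$-Brownian motion $\hat{B}$. For $\eta<\frac{2\alpha}{\sigma^2}$ and $\ell\in\mathbb{R}$ define $$f(T,\xi)=\mathbb{E}_\xi^{\hat{\mathbb{P}}}\big[e^{\frac12\eta X_T^2+\ell X_T}\big],\qquad T\ge 0,$$ which also depends on the parameters $\eta,\ell,\alpha,\delta$. Then, for all $\delta,\xi,\ell\in\mathbb{R}$, $\alpha>0$ and $\eta<\frac{2\alpha}{\sigma^2}$: 1. For every $T\ge0$ this expectation is finite. The process $X$ (with parameters $\delta,\alpha$) has a unique invariant distribution $\pi$, namely the normal law with mean $\delta/\alpha$ and variance $\sigma^2/(2\alpha)$; the function $x\mapsto e^{\frac12\eta x^2+\ell x}$ is $\pi$-integrable, and $$f(T,\xi)\to\int_{\mathbb{R}}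 e^{\frac12\eta x^2+\ell x}\,d\pi(x)\qquad\text{as } T\to\infty.$$ 2. For every $T\ge 0$ the partial derivatives $f_\eta(T,\xi)$, $f_\ell(T,\xi)$, $f_\alpha(T,\xi)$ and $f_\delta(T,\xi)$ with respect to the parameters exist, and, for fixed $\eta,\ell,\alpha,\delta,\sigma,\xi$, each of them is bounded in $T$ on $[0,\infty)$. -/

import Mathlib

open MeasureTheory ProbabilityTheory Filter Topology
open scoped NNReal

noncomputable section

/-- `X` is a (weak) solution on `(Ω, P)`, driven by the Brownian motion `B`, of
`dX_t = (δ - α X_t) dt + σ dB_t`, `X_0 = ξ`. Since the diffusion coefficient is constant, the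
stochastic integral `∫₀ᵗ σ dB_s` is `σ (B_t - B_0) = σ B_t`. -/
structure IsOUProcess {Ω : Type*} [MeasurableSpace Ω] (P : Measure Ω) (δ α σ ξ : ℝ)
    (B X : ℝ≥0 → Ω → ℝ) : Prop where
  isBrownian : IsBrownianReal B P
  aemeasurable : ∀ t, AEMeasurable (X t) P
  continuous_paths : ∀ᵐ ω ∂P, Continuous fun t => X t ω
  integral_eq : ∀ᵐ ω ∂P, ∀ t : ℝ≥0,
    X t ω = ξ + (∫ s in (0 : ℝ)..t, (δ - α * X s.toNNReal ω)) + σ * B t ω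

/-- The law of `X_t` when `X` is started at `x`, for a family of processes `X x` under measures
`P x` indexed by the starting point. -/
def transitionLaw {Ω : Type*} [MeasurableSpace Ω] (P : ℝ → Measure Ω)
    (X : ℝ → ℝ≥0 → Ω → ℝ) (t : ℝ≥0) (x : ℝ) : Measure ℝ :=
  (P x).map (X x t)

/-- `π` is an invariant distribution: it is a probability measure, and starting from `π` the law
at every time `t` is again `π`. -/
def IsInvariantDistribution {Ω : Type*} [MeasurableSpace Ω] (P : ℝ → Measure Ω)
    (X : ℝ → ℝ≥0 → Ω → ℝ) (π : Measure ℝ) : Prop :=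
  IsProbabilityMeasure π ∧
    ∀ (t : ℝ≥0) (A : Set ℝ), MeasurableSet A → ∫⁻ x, transitionLaw P X t x A ∂π = π A

/-- The payoff `x ↦ exp (η x² / 2 + ℓ x)`. -/
def quadPayoff (η ℓ x : ℝ) : ℝ :=
  Real.exp (1 / 2 * η * x ^ 2 + ℓ * x)

/-- The remainder function `f(T, ξ) = E_ξ[exp (η X_T² / 2 + ℓ X_T)]` as a function of all its
parameters; the measure and the process are indexed by `δ`, `α` and the starting point `ξ`. -/
def remainder {Ω : Type*} [MeasurableSpace Ω] (P : ℝ → ℝ → ℝ → Measure Ω)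
    (X : ℝ → ℝ → ℝ → ℝ≥0 → Ω → ℝ) (η ℓ α δ : ℝ) (T : ℝ≥0) (ξ : ℝ) : ℝ :=
  ∫ ω, quadPayoff η ℓ (X δ α ξ T ω) ∂(P δ α ξ)

end

/-! Variation of constants gives `X_T = m_T + σ e^{-αT} ∫₀ᵀ e^{αs} dB_s`. Integration by parts turns
the Wiener integral into a pathwise expression (`eq_of_linear_integral_equation`), which is an
almost sure limit of sums of independent Gaussian increments. Hence `X_T` has law `N(m_T, v_T)`
(`IsOUProcess.hasLaw`), where `m_T → δ/α`, `v_T → σ²/(2α)` and `0 ≤ v_T ≤ σ²/(2α)`.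

Invariance becomes a convolution identity, checked on characteristic functions; letting `T → ∞` in
it gives uniqueness, because the transitions forget the starting law.

Completing the square yields `f(T, ξ) = G(η, ℓ, m_T, v_T)` with `G` = `gaussianQuadIntegral`, which
is `C¹` where `ηv < 1`. The hypothesis on `η` and the bound on `v_T` keep all these points in one
compact subset of that region. Continuity of `G` gives the limit in `T`. By the chain rule, the
derivative bounds reduce to bounding the parameter derivatives of `m_T` and `v_T` uniformly in `T`,
where the only growing factor appears as `T e^{-αT} ≤ 1/α`. -/

/-- Weighted Riemann sums over the uniform partitions of `[0, T]` converge to the integral. -/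
lemma tendsto_sum_mul_intervalIntegral {f w : ℝ → ℝ} (hf : Continuous f) (hw : Continuous w)
    {T : ℝ} (hT : 0 ≤ T) {τ : ℕ → ℕ → ℝ}
    (hτ : ∀ n i : ℕ, τ n i ∈ Set.Icc (T * i / (n + 1 : ℕ)) (T * (i + 1 : ℕ) / (n + 1 : ℕ))) :
    Tendsto (fun n : ℕ => ∑ i ∈ Finset.range (n + 1),
        f (τ n i) * ∫ s in (T * i / (n + 1 : ℕ))..(T * (i + 1 : ℕ) / (n + 1 : ℕ)), w s) atTop
      (𝓝 (∫ s in (0 : ℝ)..T, f s * w s)) := by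
  have hle (n i : ℕ) : T * i / (n + 1 : ℕ) ≤ T * (i + 1 : ℕ) / (n + 1 : ℕ) := by
    gcongr; exact Nat.le_succ i
  have hsplit (n : ℕ) {g : ℝ → ℝ} (hg : Continuous g) :
      ∑ i ∈ Finset.range (n + 1),
        ∫ s in (T * i / (n + 1 : ℕ))..(T * (i + 1 : ℕ) / (n + 1 : ℕ)), g s
        = ∫ s in (0 : ℝ)..T, g s := by
    rw [intervalIntegral.sum_integral_adjacent_intervals
      (a := fun i : ℕ => T * i / (n + 1 : ℕ)) (fun k _ => hg.intervalIntegrable _ _)]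
    rw [mul_div_cancel_right₀ T (by positivity : ((n + 1 : ℕ) : ℝ) ≠ 0)]
    simp
  have hW : 0 ≤ ∫ s in (0 : ℝ)..T, |w s| :=
    intervalIntegral.integral_nonneg hT fun s _ => abs_nonneg _
  set W := ∫ s in (0 : ℝ)..T, |w s|
  have huc := (isCompact_Icc (a := (0 : ℝ)) (b := T)).uniformContinuousOn_of_continuous
    hf.continuousOn
  rw [Metric.uniformContinuousOn_iff] at huc
  rw [Metric.tendsto_atTop]
  intro ε hε
  -- The `+ 1` covers the case `W = 0` and makes the final bound `ε W / (W + 1)` strictly less than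
  -- `ε`.
  obtain ⟨d, hd, hfd⟩ := huc (ε / (W + 1)) (by positivity)
  obtain ⟨N, hN⟩ := exists_nat_gt (T / d)
  refine ⟨N, fun n hn => ?_⟩
  have hn1 : (0 : ℝ) < (n + 1 : ℕ) := by positivity
  have hstep : T / (n + 1 : ℕ) < d := by
    rw [div_lt_iff₀ hn1]
    rw [div_lt_iff₀ hd] at hN
    have : (N : ℝ) ≤ (n + 1 : ℕ) := by exact_mod_cast hn.trans (Nat.le_succ n)
    nlinarith
  have hfw : Continuous fun s => f s * w s := hf.mul hw
  rw [← hsplit n hfw, Real.dist_eq, ← Finset.sum_sub_distrib]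
  have hterm : ∀ i ∈ Finset.range (n + 1),
      |f (τ n i) * (∫ s in (T * i / (n + 1 : ℕ))..(T * (i + 1 : ℕ) / (n + 1 : ℕ)), w s)
        - ∫ s in (T * i / (n + 1 : ℕ))..(T * (i + 1 : ℕ) / (n + 1 : ℕ)), f s * w s|
      ≤ ε / (W + 1) *
        ∫ s in (T * i / (n + 1 : ℕ))..(T * (i + 1 : ℕ) / (n + 1 : ℕ)), |w s| := by
    intro i hi
    have h0 : 0 ≤ T * i / (n + 1 : ℕ) := by positivity
    have h1 : T * (i + 1 : ℕ) / (n + 1 : ℕ) ≤ T := by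
      rw [div_le_iff₀ hn1]
      gcongr
      exact Nat.lt_succ_iff.1 (Finset.mem_range.1 hi)
    have h2 : T * (i + 1 : ℕ) / (n + 1 : ℕ) - T * i / (n + 1 : ℕ) = T / (n + 1 : ℕ) := by
      push_cast; ring
    obtain ⟨ha, hb⟩ := hτ n i
    rw [← intervalIntegral.integral_const_mul, ← intervalIntegral.integral_const_mul,
      ← intervalIntegral.integral_sub ((hw.const_mul _).intervalIntegrable _ _)
        (hfw.intervalIntegrable _ _)]
    refine (intervalIntegral.abs_integral_le_integral_abs (hle n i)).trans ?_
    refine intervalIntegral.integral_mono_on (hle n i)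
      (((hw.const_mul _).sub hfw).abs.intervalIntegrable _ _)
      ((hw.abs.const_mul _).intervalIntegrable _ _) fun s hs => ?_
    rw [← sub_mul, abs_mul]
    gcongr
    have := hfd (τ n i) ⟨h0.trans ha, hb.trans h1⟩ s ⟨h0.trans hs.1, hs.2.trans h1⟩ (by
      rw [Real.dist_eq, abs_lt]
      constructor <;> linarith [hs.1, hs.2])
    exact this.le
  calc _ ≤ _ := Finset.abs_sum_le_sum_abs _ _
    _ ≤ _ := Finset.sum_le_sum hterm
    _ = ε / (W + 1) * W := by rw [← Finset.mul_sum, hsplit n hw.abs]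
    _ < ε := by
      rw [div_mul_eq_mul_div, div_lt_iff₀ (by positivity)]
      nlinarith

/-! ### Gaussian sums and their almost sure limits -/

section Gaussian

variable {Ω : Type*} [MeasurableSpace Ω] {P : Measure Ω}

/-- The sum of independent centered Gaussian variables is Gaussian. -/
lemma charFun_map_sum_of_iIndepFun_gaussianReal [IsProbabilityMeasure P] {Y : ℕ → Ω → ℝ}
    {v : ℕ → ℝ≥0} (hY : ∀ i, HasLaw (Y i) (gaussianReal 0 (v i)) P) (hind : iIndepFun Y P)
    (s : Finset ℕ) (u : ℝ) :
    charFun (P.map fun ω => ∑ i ∈ s, Y i ω) u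
      = Complex.exp (-((∑ i ∈ s, (v i : ℝ) : ℝ) * u ^ 2 / 2)) := by
  rw [iIndepFun.charFun_map_fun_finsetSum_eq_prod (fun i _ => (hY i).aemeasurable)
    (hind.restrict s)]
  simp only [Finset.prod_apply, (hY _).map_eq, charFun_gaussianReal]
  rw [← Complex.exp_sum]
  congr 1
  push_cast
  simp [Finset.sum_mul, Finset.sum_div]

/-- An almost sure limit of random variables whose characteristic functions converge to that of
a Gaussian law is Gaussian. -/
lemma hasLaw_gaussianReal_of_tendsto [IsProbabilityMeasure P] {S : ℕ → Ω → ℝ} {Z : Ω → ℝ}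
    {q : ℕ → ℝ} {v : ℝ≥0} (hS : ∀ n, AEMeasurable (S n) P)
    (hSZ : ∀ᵐ ω ∂P, Tendsto (fun n => S n ω) atTop (𝓝 (Z ω)))
    (hchar : ∀ n u, charFun (P.map (S n)) u = Complex.exp (-((q n : ℝ) * u ^ 2 / 2)))
    (hq : Tendsto q atTop (𝓝 v)) :
    HasLaw Z (gaussianReal 0 v) P := by
  have hZ : AEMeasurable Z P := aemeasurable_of_tendsto_metrizable_ae atTop hS hSZ
  refine ⟨hZ, ?_⟩
  have := Measure.isProbabilityMeasure_map hZ
  refine Measure.ext_of_charFun (funext fun u => ?_)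
  have hmap {W : Ω → ℝ} (hW : AEMeasurable W P) :
      charFun (P.map W) u = ∫ ω, Complex.exp (u * W ω * Complex.I) ∂P := by
    rw [charFun_apply_real, integral_map hW (by fun_prop)]
  have h1 : Tendsto (fun n => charFun (P.map (S n)) u) atTop (𝓝 (charFun (P.map Z) u)) := by
    rw [hmap hZ]
    simp_rw [hmap (hS _)]
    refine tendsto_integral_of_dominated_convergence (fun _ => 1) (fun n => ?_)
      (integrable_const _) (fun n => ?_) ?_
    · have := hS n
      exact AEMeasurable.aestronglyMeasurable (by fun_prop)
    · refine ae_of_all _ fun ω => ?_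
      rw [← Complex.ofReal_mul, Complex.norm_exp_ofReal_mul_I]
    · filter_upwards [hSZ] with ω hω
      have hc : Continuous fun x : ℝ => Complex.exp (u * x * Complex.I) := by fun_prop
      exact (hc.tendsto _).comp hω
  refine tendsto_nhds_unique h1 ?_
  simp_rw [hchar, charFun_gaussianReal]
  have hc : Continuous fun x : ℝ => Complex.exp (-((x : ℂ) * u ^ 2 / 2)) := by fun_prop
  convert! (hc.tendsto _).comp hq using 2
  simp

end Gaussian

/-! ### Pathwise solution of the linear equation -/

/-- Variation of constants for the linear integral equation
`x t = ξ + ∫₀ᵗ (δ - α x s) ds + σ b t`. -/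
lemma eq_of_linear_integral_equation {x b : ℝ → ℝ} (hx : Continuous x)
    {δ α σ ξ T : ℝ} (hα : α ≠ 0) (hT : 0 ≤ T)
    (h : ∀ t, 0 ≤ t → x t = ξ + (∫ s in (0 : ℝ)..t, (δ - α * x s)) + σ * b t) :
    x T = (Real.exp (-(α * T)) * ξ + δ / α * (1 - Real.exp (-(α * T))))
      + σ * Real.exp (-(α * T)) * (Real.exp (α * T) * b T
        - ∫ s in (0 : ℝ)..T, b s * (α * Real.exp (α * s))) := by
  -- `y = x - σ b` on `[0, ∞)` is the differentiable part of `x`; the integrating factor is applied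
  -- to it since `b` need not be differentiable.
  set y : ℝ → ℝ := fun t => ξ + ∫ s in (0 : ℝ)..t, (δ - α * x s) with hy
  have hc : Continuous fun s => δ - α * x s := by fun_prop
  have hyd (t : ℝ) : HasDerivAt y (δ - α * x t) t :=
    (intervalIntegral.integral_hasDerivAt_right (hc.intervalIntegrable _ _)
      hc.aestronglyMeasurable.stronglyMeasurableAtFilter hc.continuousAt).const_add ξ
  have hyc : Continuous y := continuous_iff_continuousAt.2 fun t => (hyd t).continuousAt
  have hed (t : ℝ) : HasDerivAt (fun t => Real.exp (α * t)) (Real.exp (α * t) * α) t := by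
    simpa using ((hasDerivAt_id t).const_mul α).exp
  have hprod (t : ℝ) : HasDerivAt (fun t => Real.exp (α * t) * (y t - δ / α))
      (Real.exp (α * t) * α * (y t - δ / α) + Real.exp (α * t) * (δ - α * x t)) t :=
    (hed t).mul ((hyd t).sub_const _)
  have hint := intervalIntegral.integral_eq_sub_of_hasDerivAt (a := 0) (b := T)
    (fun t _ => hprod t) (Continuous.intervalIntegrable (by fun_prop) _ _)
  -- Substituting `x = y + σ b` cancels every term in `y` and `δ`, leaving only the noise.
  have hcongr : (∫ t in (0 : ℝ)..T,
      (Real.exp (α * t) * α * (y t - δ / α) + Real.exp (α * t) * (δ - α * x t)))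
      = ∫ t in (0 : ℝ)..T, -σ * (b t * (α * Real.exp (α * t))) := by
    refine intervalIntegral.integral_congr fun t ht => ?_
    rw [Set.uIcc_of_le hT] at ht
    have hxt : x t = y t + σ * b t := h t ht.1
    simp only [hxt]
    field_simp
    ring
  rw [hcongr, intervalIntegral.integral_const_mul] at hint
  have hxT : x T = y T + σ * b T := h T hT
  have hy0 : y 0 = ξ := by simp [hy]
  rw [hy0, mul_zero, Real.exp_zero, one_mul] at hint
  have hE : Real.exp (-(α * T)) * Real.exp (α * T) = 1 := by rw [← Real.exp_add]; simp
  rw [hxT]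
  linear_combination (-Real.exp (-(α * T))) * hint + (δ / α - y T - σ * b T) * hE

/-- The variance of the Ornstein–Uhlenbeck process at time `T`. -/
noncomputable def ouVariance (α σ T : ℝ) : ℝ :=
  σ ^ 2 / (2 * α) * (1 - Real.exp (-(α * T)) ^ 2)

/-- The mean of the Ornstein–Uhlenbeck process at time `T`. -/
noncomputable def ouMean (δ α ξ T : ℝ) : ℝ :=
  Real.exp (-(α * T)) * ξ + δ / α * (1 - Real.exp (-(α * T)))

/-! ### Gaussian marginals of the process -/

section Law

variable {Ω : Type*} [MeasurableSpace Ω] {P : Measure Ω}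

/-- The variable is `∫₀ᵀ e^{αs} dB_s` after integration by parts. Summation by parts identifies it
as the limit of left-point sums `∑ e^{αpᵢ} (B_{pᵢ₊₁} - B_{pᵢ})`, whose variances are Riemann sums of
`∫ e^{2αs} ds`. -/
lemma ProbabilityTheory.IsBrownianReal.hasLaw_exp_integral {B : ℝ≥0 → Ω → ℝ}
    (hB : IsBrownianReal B P) (α : ℝ) (T : ℝ≥0) :
    HasLaw (fun ω => Real.exp (α * T) * B T ω
        - ∫ s in (0 : ℝ)..T, B s.toNNReal ω * (α * Real.exp (α * s)))
      (gaussianReal 0 (∫ s in (0 : ℝ)..T, Real.exp (α * s) ^ 2).toNNReal) P := by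
  have : IsProbabilityMeasure P := hB.isGaussianProcess.isProbabilityMeasure
  set p : ℕ → ℕ → ℝ≥0 := fun n i => T * i / (n + 1 : ℕ) with hp
  have hpmono (n : ℕ) : Monotone (p n) := fun i j hij => by
    simp only [hp]; gcongr
  have hpcoe (n i : ℕ) : ((p n i : ℝ≥0) : ℝ) = T * i / (n + 1 : ℕ) := by simp [hp]
  set v : ℕ → ℕ → ℝ≥0 := fun n i =>
    NNReal.mk (Real.exp (α * p n i) ^ 2) (sq_nonneg _) * nndist (p n (i + 1)).1 (p n i).1 with hv
  have hlaw (n i : ℕ) :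
      HasLaw (fun ω => Real.exp (α * p n i) * (B (p n (i + 1)) ω - B (p n i) ω))
        (gaussianReal 0 (v n i)) P := by
    simpa using! gaussianReal_const_mul (hB.hasLaw_sub (p n (i + 1)) (p n i))
      (Real.exp (α * p n i))
  have hind (n : ℕ) :
      iIndepFun (fun i ω => Real.exp (α * p n i) * (B (p n (i + 1)) ω - B (p n i) ω)) P :=
    (hB.hasIndepIncrements.nat (hpmono n)).comp (fun i x => Real.exp (α * p n i) * x)
      (fun i => by fun_prop)
  have hT0 : (0 : ℝ) ≤ T := T.coe_nonneg
  have hQ : 0 ≤ ∫ s in (0 : ℝ)..T, Real.exp (α * s) ^ 2 :=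
    intervalIntegral.integral_nonneg hT0 fun s _ => sq_nonneg _
  refine hasLaw_gaussianReal_of_tendsto
    (S := fun n ω => ∑ i ∈ Finset.range (n + 1),
      Real.exp (α * p n i) * (B (p n (i + 1)) ω - B (p n i) ω))
    (q := fun n => ∑ i ∈ Finset.range (n + 1), (v n i : ℝ)) (fun n => ?_) ?_
    (fun n u => charFun_map_sum_of_iIndepFun_gaussianReal (hlaw n) (hind n) _ u) ?_
  · exact Finset.aemeasurable_fun_sum _ fun i _ => (hlaw n i).aemeasurable
  · filter_upwards [hB.cont, hB.eval_zero_ae_eq_zero] with ω hω hω0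
    have hbc : Continuous fun s : ℝ => B s.toNNReal ω := hω.comp continuous_real_toNNReal
    have hw : Continuous fun s : ℝ => α * Real.exp (α * s) := by fun_prop
    have hwint (a b : ℝ) : ∫ s in a..b, α * Real.exp (α * s)
        = Real.exp (α * b) - Real.exp (α * a) :=
      intervalIntegral.integral_eq_sub_of_hasDerivAt
        (fun t _ => by simpa [mul_comm] using ((hasDerivAt_id t).const_mul α).exp)
        (hw.intervalIntegrable _ _)
    -- Right endpoints are forced: with `e` at the left in the stochastic sum, the telescoping of `e
    -- B` leaves `B_{pᵢ₊₁} (e_{pᵢ₊₁} - e_{pᵢ})`.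
    have hlim := (tendsto_sum_mul_intervalIntegral hbc hw hT0
      (τ := fun n i => p n (i + 1)) (fun n i => by
        rw [← hpcoe, ← hpcoe]
        exact ⟨hpmono n (Nat.le_succ i), le_rfl⟩)).const_sub (Real.exp (α * T) * B T ω)
    refine hlim.congr fun n => ?_
    have htel := Finset.sum_range_sub (fun i => Real.exp (α * p n i) * B (p n i) ω) (n + 1)
    have hpT : p n (n + 1) = T := by
      simp only [hp]
      exact mul_div_cancel_right₀ T (by positivity)
    have hp0 : p n 0 = 0 := by simp [hp]
    simp only [hpT, hp0, hω0, mul_zero, sub_zero] at htel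
    rw [← htel, ← Finset.sum_sub_distrib]
    refine Finset.sum_congr rfl fun i _ => ?_
    rw [hwint, ← hpcoe, ← hpcoe, Real.toNNReal_coe]
    ring
  · rw [Real.coe_toNNReal _ hQ]
    have hlim := tendsto_sum_mul_intervalIntegral (f := fun s => Real.exp (α * s) ^ 2)
      (w := fun _ => 1) (by fun_prop) continuous_const hT0 (τ := fun n i => p n i) (fun n i => by
        rw [← hpcoe, ← hpcoe]
        exact ⟨le_rfl, hpmono n (Nat.le_succ i)⟩)
    simp only [mul_one] at hlim
    refine hlim.congr fun n => Finset.sum_congr rfl fun i _ => ?_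
    have hle : (p n i : ℝ) ≤ p n (i + 1) := hpmono n (Nat.le_succ i)
    have hd : ((nndist (p n (i + 1)).1 (p n i).1 : ℝ≥0) : ℝ) = p n (i + 1) - p n i := by
      rw [coe_nndist, Real.dist_eq]
      exact abs_of_nonneg (sub_nonneg.2 hle)
    rw [← hpcoe, ← hpcoe, intervalIntegral.integral_const]
    simp only [hv, NNReal.coe_mul, NNReal.coe_mk, hd, smul_eq_mul, mul_one]

/-- The marginals of the Ornstein–Uhlenbeck process are Gaussian. -/
lemma IsOUProcess.hasLaw {δ α σ ξ : ℝ} {B X : ℝ≥0 → Ω → ℝ} (h : IsOUProcess P δ α σ ξ B X)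
    (hα : 0 < α) (T : ℝ≥0) :
    HasLaw (X T) (gaussianReal (ouMean δ α ξ T) (ouVariance α σ T).toNNReal) P := by
  have hT0 : (0 : ℝ) ≤ T := T.coe_nonneg
  have hZ := gaussianReal_const_add (gaussianReal_const_mul
    (h.isBrownian.hasLaw_exp_integral α T) (σ * Real.exp (-(α * T)))) (ouMean δ α ξ T)
  have hQ : ∫ s in (0 : ℝ)..T, Real.exp (α * s) ^ 2
      = Real.exp (α * T) ^ 2 / (2 * α) - 1 / (2 * α) := by
    have hd (t : ℝ) : HasDerivAt (fun t => Real.exp (α * t) ^ 2 / (2 * α))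
        (Real.exp (α * t) ^ 2) t := by
      refine (((((hasDerivAt_id t).const_mul α).exp).pow 2).div_const (2 * α)).congr_deriv ?_
      simp
      field_simp
    rw [intervalIntegral.integral_eq_sub_of_hasDerivAt (fun t _ => hd t)
      (Continuous.intervalIntegrable (by fun_prop) _ _)]
    simp
  convert! hZ.congr ?_ using 1
  · congr 1
    · simp
    · rw [hQ]
      have hE : Real.exp (-(α * T)) * Real.exp (α * T) = 1 := by rw [← Real.exp_add]; simp
      have hm : NNReal.mk ((σ * Real.exp (-(α * T))) ^ 2) (sq_nonneg _)
          = ((σ * Real.exp (-(α * T))) ^ 2).toNNReal :=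
        (Real.toNNReal_of_nonneg (sq_nonneg _)).symm
      rw [hm, ← Real.toNNReal_mul (sq_nonneg _), ouVariance]
      congr 1
      linear_combination (-σ ^ 2 / (2 * α) * (Real.exp (-(α * T)) * Real.exp (α * T) + 1)) * hE
  · filter_upwards [h.continuous_paths, h.integral_eq] with ω hx heq
    have := eq_of_linear_integral_equation (x := fun s : ℝ => X s.toNNReal ω)
      (b := fun s : ℝ => B s.toNNReal ω) (hx.comp continuous_real_toNNReal) hα.ne' hT0 (fun t ht => by
        simpa [Real.coe_toNNReal _ ht] using heq t.toNNReal)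
    simpa only [Real.toNNReal_coe, ouMean] using this

end Law

/-! ### Invariant distribution -/

lemma conv_gaussianReal_apply (μ : Measure ℝ) [SFinite μ] (v : ℝ≥0) {A : Set ℝ}
    (hA : MeasurableSet A) :
    (μ ∗ gaussianReal 0 v) A = ∫⁻ x, gaussianReal x v A ∂μ := by
  rw [← lintegral_indicator_one hA, Measure.lintegral_conv (measurable_one.indicator hA)]
  refine lintegral_congr fun x => ?_
  have h := gaussianReal_map_const_add (μ := 0) (v := v) x
  rw [zero_add] at h
  rw [← h, ← lintegral_indicator_one hA, lintegral_map (measurable_one.indicator hA) (by fun_prop)]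

lemma ouMean_eq (δ α x T : ℝ) :
    ouMean δ α x T = Real.exp (-(α * T)) * x + δ / α * (1 - Real.exp (-(α * T))) := rfl

@[fun_prop]
lemma measurable_ouMean (δ α T : ℝ) : Measurable fun x => ouMean δ α x T := by
  simp only [ouMean_eq]; fun_prop

lemma tendsto_exp_neg_mul_atTop {α : ℝ} (hα : 0 < α) :
    Tendsto (fun T : ℝ≥0 => Real.exp (-(α * T))) atTop (𝓝 0) :=
  Real.tendsto_exp_neg_atTop_nhds_zero.comp
    ((NNReal.tendsto_coe_atTop.2 tendsto_id).const_mul_atTop hα)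

lemma tendsto_ouMean {α : ℝ} (hα : 0 < α) (δ x : ℝ) :
    Tendsto (fun T : ℝ≥0 => ouMean δ α x T) atTop (𝓝 (δ / α)) := by
  have h := tendsto_exp_neg_mul_atTop hα
  simpa [ouMean_eq] using (h.mul_const x).add ((h.const_sub 1).const_mul (δ / α))

lemma tendsto_ouVariance {α : ℝ} (hα : 0 < α) (σ : ℝ) :
    Tendsto (fun T : ℝ≥0 => ouVariance α σ T) atTop (𝓝 (σ ^ 2 / (2 * α))) := by
  have h := tendsto_exp_neg_mul_atTop hα
  simpa [ouVariance] using ((h.pow 2).const_sub 1).const_mul (σ ^ 2 / (2 * α))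

lemma exp_neg_mul_mem_Ioc {α T : ℝ} (hα : 0 < α) (hT : 0 ≤ T) :
    Real.exp (-(α * T)) ∈ Set.Ioc 0 1 :=
  ⟨Real.exp_pos _, Real.exp_le_one_iff.2 (neg_nonpos.2 (by positivity))⟩

lemma ouVariance_mem_Icc {α T : ℝ} (hα : 0 < α) (σ : ℝ) (hT : 0 ≤ T) :
    ouVariance α σ T ∈ Set.Icc 0 (σ ^ 2 / (2 * α)) := by
  obtain ⟨h0, h1⟩ := exp_neg_mul_mem_Ioc hα hT
  have hV : 0 ≤ σ ^ 2 / (2 * α) := by positivity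
  exact ⟨mul_nonneg hV (by nlinarith), mul_le_of_le_one_right hV (by nlinarith)⟩

lemma charFun_map_ouMean (μ : Measure ℝ) (δ α T u : ℝ) :
    charFun (μ.map fun x => ouMean δ α x T) u
      = charFun μ (Real.exp (-(α * T)) * u)
        * Complex.exp ((δ / α * (1 - Real.exp (-(α * T))) * u : ℝ) * Complex.I) := by
  have : (fun x => ouMean δ α x T)
      = (fun y => y + δ / α * (1 - Real.exp (-(α * T)))) ∘ fun x => Real.exp (-(α * T)) * x := rfl
  rw [this, ← Measure.map_map (by fun_prop) (by fun_prop), charFun_map_add_const, charFun_map_mul]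
  simp [mul_comm]

/-- The law `N(δ / α, σ² / (2 α))` is preserved by the Ornstein–Uhlenbeck transitions. -/
lemma gaussianReal_conv_ou {α : ℝ} (hα : 0 < α) (δ σ : ℝ) {T : ℝ} (hT : 0 ≤ T) :
    ((gaussianReal (δ / α) (σ ^ 2 / (2 * α)).toNNReal).map fun x => ouMean δ α x T)
      ∗ gaussianReal 0 (ouVariance α σ T).toNNReal
      = gaussianReal (δ / α) (σ ^ 2 / (2 * α)).toNNReal := by
  have := Measure.isProbabilityMeasure_map (μ := gaussianReal (δ / α) (σ ^ 2 / (2 * α)).toNNReal)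
    (measurable_ouMean δ α T).aemeasurable
  refine Measure.ext_of_charFun (funext fun u => ?_)
  rw [charFun_conv, charFun_map_ouMean, charFun_gaussianReal, charFun_gaussianReal,
    charFun_gaussianReal, Real.coe_toNNReal _ (by positivity),
    Real.coe_toNNReal _ (ouVariance_mem_Icc hα σ hT).1, ← Complex.exp_add, ← Complex.exp_add]
  congr 1
  simp only [ouVariance]
  push_cast
  ring

/-- A probability measure preserved by the Ornstein–Uhlenbeck transitions is
`N(δ / α, σ² / (2 α))`. -/
lemma eq_gaussianReal_of_conv_ou {α : ℝ} (hα : 0 < α) (δ σ : ℝ) {μ : Measure ℝ}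
    [IsProbabilityMeasure μ]
    (h : ∀ T : ℝ≥0, (μ.map fun x => ouMean δ α x T)
      ∗ gaussianReal 0 (ouVariance α σ T).toNNReal = μ) :
    μ = gaussianReal (δ / α) (σ ^ 2 / (2 * α)).toNNReal := by
  refine Measure.ext_of_charFun (funext fun u => ?_)
  have hθ := tendsto_exp_neg_mul_atTop hα
  -- The factor carrying the starting law tends to `charFun μ 0 = 1`, so the limit no longer depends
  -- on `μ`.
  have h1 : Tendsto (fun T : ℝ≥0 => charFun μ (Real.exp (-(α * T)) * u)) atTop (𝓝 1) := by
    have := (continuous_charFun (μ := μ)).continuousAt (x := 0)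
    simp only [ContinuousAt, charFun_zero, probReal_univ, Complex.ofReal_one] at this
    exact this.comp (by simpa using hθ.mul_const u)
  have h2 : Tendsto (fun T : ℝ≥0 =>
      Complex.exp ((δ / α * (1 - Real.exp (-(α * T))) * u : ℝ) * Complex.I)) atTop
      (𝓝 (Complex.exp ((δ / α * (1 - 0) * u : ℝ) * Complex.I))) := by
    have hc : Continuous fun y : ℝ =>
        Complex.exp ((δ / α * (1 - y) * u : ℝ) * Complex.I) := by fun_prop
    exact (hc.tendsto 0).comp hθ
  have h3 : Tendsto (fun T : ℝ≥0 => charFun (gaussianReal 0 (ouVariance α σ T).toNNReal) u) atTop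
      (𝓝 (charFun (gaussianReal 0 (σ ^ 2 / (2 * α)).toNNReal) u)) := by
    simp_rw [charFun_gaussianReal]
    have hc : Continuous fun y : ℝ =>
        Complex.exp (u * (0 : ℝ) * Complex.I - (y.toNNReal : ℝ) * u ^ 2 / 2) := by fun_prop
    exact (hc.tendsto _).comp (tendsto_ouVariance hα σ)
  have h4 := (h1.mul h2).mul h3
  have hconst (T : ℝ≥0) : charFun μ (Real.exp (-(α * T)) * u)
      * Complex.exp ((δ / α * (1 - Real.exp (-(α * T))) * u : ℝ) * Complex.I)
      * charFun (gaussianReal 0 (ouVariance α σ T).toNNReal) u = charFun μ u := by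
    have := Measure.isProbabilityMeasure_map (μ := μ) (measurable_ouMean δ α T).aemeasurable
    rw [← charFun_map_ouMean, ← charFun_conv, h T]
  simp_rw [hconst] at h4
  rw [tendsto_nhds_unique tendsto_const_nhds h4, charFun_gaussianReal, charFun_gaussianReal,
    one_mul, ← Complex.exp_add]
  congr 1
  push_cast
  ring

/-- One transition from `x` is an affine image of `x` plus independent centered Gaussian noise whose
variance does not depend on `x`, so mixing over `μ` is a convolution. -/
lemma isInvariantDistribution_iff {Ω : Type*} [MeasurableSpace Ω] {P : ℝ → Measure Ω}
    {B X : ℝ → ℝ≥0 → Ω → ℝ} {δ α σ : ℝ} (hα : 0 < α)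
    (hX : ∀ ξ, IsOUProcess (P ξ) δ α σ ξ (B ξ) (X ξ)) (μ : Measure ℝ) :
    IsInvariantDistribution P X μ ↔ IsProbabilityMeasure μ ∧
      ∀ T : ℝ≥0, (μ.map fun x => ouMean δ α x T)
        ∗ gaussianReal 0 (ouVariance α σ T).toNNReal = μ := by
  refine and_congr_right fun hμ => forall_congr' fun T => ?_
  rw [Measure.ext_iff]
  refine forall₂_congr fun A hA => ?_
  have hm : Measurable fun x => gaussianReal x (ouVariance α σ T).toNNReal A :=
    (Measure.measurable_coe hA).comp (measurable_gaussianReal.comp (by fun_prop :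
      Measurable fun x : ℝ => (x, (ouVariance α σ T).toNNReal)))
  rw [conv_gaussianReal_apply _ _ hA, lintegral_map hm (by fun_prop)]
  simp only [transitionLaw, ((hX _).hasLaw hα T).map_eq]

/-! ### Exponential quadratic moments of Gaussian laws -/

/-- The integral of `quadPayoff η ℓ` against `N(m, v)`, as a function of `(η, ℓ, m, v)`. -/
noncomputable def gaussianQuadIntegral (p : ℝ × ℝ × ℝ × ℝ) : ℝ :=
  (√(1 - p.1 * p.2.2.2))⁻¹ *
    Real.exp ((1 / 2 * p.1 * p.2.2.1 ^ 2 + p.2.1 * p.2.2.1 + 1 / 2 * p.2.1 ^ 2 * p.2.2.2)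
      / (1 - p.1 * p.2.2.2))

/-- Completing the square: tilting by the payoff gives another Gaussian density times a constant, so
integrability and the integral both follow at once. -/
lemma gaussianPDFReal_mul_quadPayoff {η ℓ m : ℝ} {v : ℝ≥0} (hv : v ≠ 0) (h : η * v < 1) (x : ℝ) :
    gaussianPDFReal m v x * quadPayoff η ℓ x = gaussianQuadIntegral (η, ℓ, m, v)
      * gaussianPDFReal ((m + ℓ * v) / (1 - η * v)) (v / (1 - η * v)).toNNReal x := by
  have hk : 0 < 1 - η * v := by linarith
  have hv0 : (0 : ℝ) < v := NNReal.coe_pos.2 (pos_iff_ne_zero.2 hv)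
  rw [gaussianPDFReal, gaussianPDFReal, quadPayoff, gaussianQuadIntegral,
    Real.coe_toNNReal _ (by positivity)]
  have hs : √(2 * Real.pi * (v / (1 - η * v))) = √(2 * Real.pi * v) / √(1 - η * v) := by
    rw [← mul_div_assoc, Real.sqrt_div (by positivity)]
  have hk' : √(1 - η * v) ≠ 0 := (Real.sqrt_pos.2 hk).ne'
  rw [hs, mul_assoc, ← Real.exp_add, mul_mul_mul_comm, ← Real.exp_add, inv_div, ← mul_div_assoc,
    inv_mul_cancel₀ hk']
  congr 1
  · rw [one_div]
  congr 1
  dsimp only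
  obtain ⟨k, hkv⟩ : ∃ k, 1 - η * v = k := ⟨_, rfl⟩
  have hk0 : k ≠ 0 := hkv ▸ hk.ne'
  -- Trading `η` for `k = 1 - η v` makes the exponent identity rational with denominators `v` and
  -- `k`, both known to be nonzero.
  have hη : η = (1 - k) / v := by rw [eq_div_iff hv0.ne']; linarith
  rw [hkv, hη]
  field_simp
  ring

lemma integrable_quadPayoff_gaussianReal {η m : ℝ} {v : ℝ≥0} (h : η * v < 1) (ℓ : ℝ) :
    Integrable (quadPayoff η ℓ) (gaussianReal m v) := by
  -- The Dirac case has no density; it is needed because the variance vanishes at `T = 0`.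
  rcases eq_or_ne v 0 with rfl | hv
  · rw [gaussianReal_zero_var]
    exact integrable_dirac (by simp)
  · rw [gaussianReal_of_var_ne_zero m hv, integrable_withDensity_iff_integrable_smul'
      (measurable_gaussianPDF m v) (ae_of_all _ fun _ => gaussianPDF_lt_top)]
    simp_rw [toReal_gaussianPDF, smul_eq_mul, gaussianPDFReal_mul_quadPayoff hv h]
    exact (integrable_gaussianPDFReal _ _).const_mul _

lemma integral_quadPayoff_gaussianReal {η m : ℝ} {v : ℝ≥0} (h : η * v < 1) (ℓ : ℝ) :
    ∫ x, quadPayoff η ℓ x ∂(gaussianReal m v) = gaussianQuadIntegral (η, ℓ, m, v) := by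
  rcases eq_or_ne v 0 with rfl | hv
  · simp [gaussianReal_zero_var, quadPayoff, gaussianQuadIntegral]
  · have hk : 0 < 1 - η * v := by linarith
    rw [integral_gaussianReal_eq_integral_smul hv]
    simp_rw [smul_eq_mul, gaussianPDFReal_mul_quadPayoff hv h]
    rw [integral_const_mul, integral_gaussianPDFReal_eq_one, mul_one]
    simp only [ne_eq, Real.toNNReal_eq_zero, not_le]
    exact div_pos (NNReal.coe_pos.2 (pos_iff_ne_zero.2 hv)) hk

lemma contDiffAt_gaussianQuadIntegral {p : ℝ × ℝ × ℝ × ℝ} (hp : p.1 * p.2.2.2 < 1) :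
    ContDiffAt ℝ 1 gaussianQuadIntegral p := by
  have hk : 1 - p.1 * p.2.2.2 ≠ 0 := by linarith
  have hs : √(1 - p.1 * p.2.2.2) ≠ 0 := (Real.sqrt_pos.2 (by linarith)).ne'
  have hd : ContDiffAt ℝ 1 (fun p : ℝ × ℝ × ℝ × ℝ => 1 - p.1 * p.2.2.2) p := by fun_prop
  have hn : ContDiffAt ℝ 1 (fun p : ℝ × ℝ × ℝ × ℝ => 1 / 2 * p.1 * p.2.2.1 ^ 2
    + p.2.1 * p.2.2.1 + 1 / 2 * p.2.1 ^ 2 * p.2.2.2) p := by fun_prop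
  exact ((hd.sqrt hk).inv hs).mul (hn.div hd hk).exp

/-! ### Bounds uniform in time -/

/-- Along a family of curves through a compact subset of the domain of a `C¹` function, with
bounded velocities, the composition has bounded derivatives. -/
lemma exists_forall_abs_deriv_le {E ι : Type*} [NormedAddCommGroup E] [NormedSpace ℝ E]
    {F : E → ℝ} {K : Set E} (hK : IsCompact K) (hF : ∀ p ∈ K, ContDiffAt ℝ 1 F p)
    {f : ι → ℝ → ℝ} {c : ι → ℝ → E} {c' : ι → E} {a D : ℝ}
    (hf : ∀ T, f T =ᶠ[𝓝 a] F ∘ c T) (hc : ∀ T, HasDerivAt (c T) (c' T) a)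
    (hcK : ∀ T, c T a ∈ K) (hD : ∀ T, ‖c' T‖ ≤ D) :
    ∃ C : ℝ, ∀ T, DifferentiableAt ℝ (f T) a ∧ |deriv (f T) a| ≤ C := by
  have hcont : ContinuousOn (fderiv ℝ F) K := fun p hp =>
    ((hF p hp).fderiv_right (m := 0) le_rfl).continuousAt.continuousWithinAt
  obtain ⟨M, hM⟩ := hK.exists_bound_of_continuousOn hcont
  refine ⟨M * D, fun T => ?_⟩
  have hd : HasDerivAt (f T) (fderiv ℝ F (c T a) (c' T)) a :=
    ((((hF _ (hcK T)).differentiableAt one_ne_zero).hasFDerivAt).comp_hasDerivAt a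
      (hc T)).congr_of_eventuallyEq (hf T)
  refine ⟨hd.differentiableAt, ?_⟩
  rw [hd.deriv, ← Real.norm_eq_abs]
  have hM0 := hM _ (hcK T)
  exact (ContinuousLinearMap.le_opNorm _ _).trans
    (mul_le_mul hM0 (hD T) (norm_nonneg _) ((norm_nonneg _).trans hM0))

lemma mul_ouVariance_lt_one {α σ η T : ℝ} (hσ : 0 < σ) (hα : 0 < α) (hη : η < 2 * α / σ ^ 2)
    (hT : 0 ≤ T) : η * ouVariance α σ T < 1 := by
  obtain ⟨h0, h1⟩ := ouVariance_mem_Icc hα σ hT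
  rcases le_or_gt η 0 with h | h
  · nlinarith
  · calc η * ouVariance α σ T ≤ η * (σ ^ 2 / (2 * α)) := by gcongr
      _ < 2 * α / σ ^ 2 * (σ ^ 2 / (2 * α)) := by gcongr
      _ = 1 := by field_simp

lemma mul_stationary_variance_lt_one {α σ η : ℝ} (hσ : 0 < σ) (hα : 0 < α)
    (hη : η < 2 * α / σ ^ 2) : η * (σ ^ 2 / (2 * α)) < 1 := by
  calc η * (σ ^ 2 / (2 * α)) < 2 * α / σ ^ 2 * (σ ^ 2 / (2 * α)) := by gcongr
    _ = 1 := by field_simp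

lemma abs_ouMean_le {δ α ξ T : ℝ} (hα : 0 < α) (hT : 0 ≤ T) :
    |ouMean δ α ξ T| ≤ |ξ| + |δ / α| := by
  obtain ⟨h0, h1⟩ := exp_neg_mul_mem_Ioc hα hT
  rw [ouMean_eq]
  refine (abs_add_le _ _).trans (add_le_add ?_ ?_)
  · rw [abs_mul, abs_of_pos h0]
    exact mul_le_of_le_one_left (abs_nonneg _) h1
  · rw [abs_mul, abs_of_nonneg (sub_nonneg.2 h1)]
    exact mul_le_of_le_one_right (abs_nonneg _) (by linarith)

lemma hasDerivAt_ouMean_drift (δ α ξ T : ℝ) :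
    HasDerivAt (fun δ' => ouMean δ' α ξ T) ((1 - Real.exp (-(α * T))) / α) δ := by
  simp only [ouMean_eq]
  refine ((((hasDerivAt_id δ).div_const α).mul_const _).const_add _).congr_deriv ?_
  ring

lemma hasDerivAt_exp_neg_mul (α T : ℝ) :
    HasDerivAt (fun α' => Real.exp (-(α' * T))) (-(T * Real.exp (-(α * T)))) α := by
  refine ((hasDerivAt_id α).mul_const T).neg.exp.congr_deriv ?_
  simp [mul_comm]

lemma hasDerivAt_ouMean_rate {α : ℝ} (hα : α ≠ 0) (δ ξ T : ℝ) :
    HasDerivAt (fun α' => ouMean δ α' ξ T)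
      (T * Real.exp (-(α * T)) * (δ / α - ξ) - δ / α ^ 2 * (1 - Real.exp (-(α * T)))) α := by
  simp only [ouMean_eq]
  have he := hasDerivAt_exp_neg_mul α T
  refine ((he.mul_const ξ).add
    (((hasDerivAt_id α).fun_inv hα |>.const_mul δ).mul (he.const_sub 1))).congr_deriv ?_
  simp
  field_simp
  ring

lemma hasDerivAt_ouVariance_rate {α : ℝ} (hα : α ≠ 0) (σ T : ℝ) :
    HasDerivAt (fun α' => ouVariance α' σ T)
      (σ ^ 2 / α * (T * Real.exp (-(α * T))) * Real.exp (-(α * T))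
        - σ ^ 2 / (2 * α ^ 2) * (1 - Real.exp (-(α * T)) ^ 2)) α := by
  simp only [ouVariance]
  have he := hasDerivAt_exp_neg_mul α T
  refine ((((hasDerivAt_id α).const_mul 2).fun_inv (by simpa using hα) |>.const_mul
    (σ ^ 2)).mul ((he.pow 2).const_sub 1)).congr_deriv ?_
  simp
  field_simp
  ring

/-- This is `αT ≤ e^{αT}`; it absorbs the factor `T` produced by differentiating `e^{-αT}` in `α`.
-/
lemma abs_mul_exp_neg_mul_le {α T : ℝ} (hα : 0 < α) (hT : 0 ≤ T) :
    |T * Real.exp (-(α * T))| ≤ 1 / α := by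
  rw [abs_of_nonneg (by positivity), Real.exp_neg, ← div_eq_mul_inv, div_le_div_iff₀
    (Real.exp_pos _) hα]
  linarith [Real.add_one_le_exp (α * T)]

/-! ### The remainder function and the main theorem -/

section Remainder

variable {Ω : Type*} [MeasurableSpace Ω] {σ : ℝ} {P : ℝ → ℝ → ℝ → Measure Ω}
  {B X : ℝ → ℝ → ℝ → ℝ≥0 → Ω → ℝ}

lemma integrable_quadPayoff_ou (hσ : 0 < σ)
    (hX : ∀ δ α ξ : ℝ, 0 < α → IsOUProcess (P δ α ξ) δ α σ ξ (B δ α ξ) (X δ α ξ))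
    {δ α ξ η : ℝ} (ℓ : ℝ) (hα : 0 < α) (hη : η < 2 * α / σ ^ 2) (T : ℝ≥0) :
    Integrable (fun ω => quadPayoff η ℓ (X δ α ξ T ω)) (P δ α ξ) := by
  have hlaw := (hX δ α ξ hα).hasLaw hα T
  have hv : η * ((ouVariance α σ T).toNNReal : ℝ) < 1 := by
    rw [Real.coe_toNNReal _ (ouVariance_mem_Icc hα σ T.coe_nonneg).1]
    exact mul_ouVariance_lt_one hσ hα hη T.coe_nonneg
  have h := integrable_quadPayoff_gaussianReal (m := ouMean δ α ξ T) hv ℓ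
  rw [← hlaw.map_eq] at h
  exact h.comp_aemeasurable hlaw.aemeasurable

lemma remainder_eq_gaussianQuadIntegral (hσ : 0 < σ)
    (hX : ∀ δ α ξ : ℝ, 0 < α → IsOUProcess (P δ α ξ) δ α σ ξ (B δ α ξ) (X δ α ξ))
    {δ α ξ η : ℝ} (ℓ : ℝ) (hα : 0 < α) (hη : η < 2 * α / σ ^ 2) (T : ℝ≥0) :
    remainder P X η ℓ α δ T ξ
      = gaussianQuadIntegral (η, ℓ, ouMean δ α ξ T, ouVariance α σ T) := by
  have hlaw := (hX δ α ξ hα).hasLaw hα T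
  have h0 := Real.coe_toNNReal _ (ouVariance_mem_Icc hα σ T.coe_nonneg).1
  have hv : η * ((ouVariance α σ T).toNNReal : ℝ) < 1 := by
    rw [h0]
    exact mul_ouVariance_lt_one hσ hα hη T.coe_nonneg
  have h := integral_quadPayoff_gaussianReal (m := ouMean δ α ξ T) hv ℓ
  rw [h0] at h
  rw [remainder, ← h, ← hlaw.map_eq, integral_map hlaw.aemeasurable]
  exact (Continuous.aestronglyMeasurable (by unfold quadPayoff; fun_prop))

end Remainder

theorem mainTheorem5 {Ω : Type*} [MeasurableSpace Ω] (σ : ℝ) (hσ : 0 < σ)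
    (P : ℝ → ℝ → ℝ → Measure Ω) (B X : ℝ → ℝ → ℝ → ℝ≥0 → Ω → ℝ)
    (hX : ∀ δ α ξ : ℝ, 0 < α → IsOUProcess (P δ α ξ) δ α σ ξ (B δ α ξ) (X δ α ξ))
    (δ α ξ η ℓ : ℝ) (hα : 0 < α) (hη : η < 2 * α / σ ^ 2) :
    (∀ T : ℝ≥0, Integrable (fun ω => quadPayoff η ℓ (X δ α ξ T ω)) (P δ α ξ)) ∧
    (∃ π : Measure ℝ,
      IsInvariantDistribution (P δ α) (X δ α) π ∧
      (∀ π' : Measure ℝ, IsInvariantDistribution (P δ α) (X δ α) π' → π' = π) ∧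
      π = gaussianReal (δ / α) (σ ^ 2 / (2 * α)).toNNReal ∧
      Integrable (quadPayoff η ℓ) π ∧
      Tendsto (fun T : ℝ≥0 => remainder P X η ℓ α δ T ξ) atTop
        (𝓝 (∫ x, quadPayoff η ℓ x ∂π))) ∧
    (∃ C : ℝ, ∀ T : ℝ≥0,
      DifferentiableAt ℝ (fun η' => remainder P X η' ℓ α δ T ξ) η ∧
      |deriv (fun η' => remainder P X η' ℓ α δ T ξ) η| ≤ C) ∧
    (∃ C : ℝ, ∀ T : ℝ≥0,
      DifferentiableAt ℝ (fun ℓ' => remainder P X η ℓ' α δ T ξ) ℓ ∧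
      |deriv (fun ℓ' => remainder P X η ℓ' α δ T ξ) ℓ| ≤ C) ∧
    (∃ C : ℝ, ∀ T : ℝ≥0,
      DifferentiableAt ℝ (fun α' => remainder P X η ℓ α' δ T ξ) α ∧
      |deriv (fun α' => remainder P X η ℓ α' δ T ξ) α| ≤ C) ∧
    (∃ C : ℝ, ∀ T : ℝ≥0,
      DifferentiableAt ℝ (fun δ' => remainder P X η ℓ α δ' T ξ) δ ∧
      |deriv (fun δ' => remainder P X η ℓ α δ' T ξ) δ| ≤ C) := by
  have hinv := isInvariantDistribution_iff hα fun ξ => hX δ α ξ hα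
  have hV := mul_stationary_variance_lt_one hσ hα hη
  have hV0 : 0 ≤ σ ^ 2 / (2 * α) := by positivity
  have hVη : η * ((σ ^ 2 / (2 * α)).toNNReal : ℝ) < 1 := by rwa [Real.coe_toNNReal _ hV0]
  set R := |ξ| + |δ / α|
  -- Contains the points `(η, ℓ, m_T, v_T)` for all `T ≥ 0`, at the fixed parameter values.
  set K : Set (ℝ × ℝ × ℝ × ℝ) :=
    {η} ×ˢ {ℓ} ×ˢ Set.Icc (-R) R ×ˢ Set.Icc 0 (σ ^ 2 / (2 * α))
  have hK : IsCompact K :=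
    isCompact_singleton.prod (isCompact_singleton.prod (isCompact_Icc.prod isCompact_Icc))
  have hF : ∀ p ∈ K, ContDiffAt ℝ 1 gaussianQuadIntegral p := by
    rintro ⟨a, b, m, v⟩ ⟨rfl, -, -, hv⟩
    refine contDiffAt_gaussianQuadIntegral ?_
    have hv0 : 0 ≤ v := hv.1
    have hv1 : v ≤ σ ^ 2 / (2 * α) := hv.2
    change a * v < 1
    rcases le_or_gt a 0 with h | h <;> nlinarith
  have hmem (T : ℝ≥0) : (η, ℓ, ouMean δ α ξ T, ouVariance α σ T) ∈ K :=
    ⟨rfl, rfl, abs_le.1 (abs_ouMean_le hα T.coe_nonneg), ouVariance_mem_Icc hα σ T.coe_nonneg⟩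
  have hrem {η α : ℝ} (ℓ δ : ℝ) (hα : 0 < α) (hη : η < 2 * α / σ ^ 2) (T : ℝ≥0) :
      remainder P X η ℓ α δ T ξ
        = gaussianQuadIntegral (η, ℓ, ouMean δ α ξ T, ouVariance α σ T) :=
    remainder_eq_gaussianQuadIntegral hσ hX ℓ hα hη T
  have hθ (T : ℝ≥0) := exp_neg_mul_mem_Ioc hα T.coe_nonneg
  refine ⟨integrable_quadPayoff_ou hσ hX ℓ hα hη, ⟨_, (hinv _).2 ⟨inferInstance,
    fun T => gaussianReal_conv_ou hα δ σ T.coe_nonneg⟩, fun π' hπ' => ?_, rfl,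
    integrable_quadPayoff_gaussianReal hVη ℓ, ?_⟩, ?_, ?_, ?_, ?_⟩
  · have := ((hinv π').1 hπ').1
    exact eq_gaussianReal_of_conv_ou hα δ σ ((hinv π').1 hπ').2
  · rw [integral_quadPayoff_gaussianReal hVη, Real.coe_toNNReal _ hV0]
    simp_rw [hrem ℓ δ hα hη]
    have hc : ContinuousAt gaussianQuadIntegral (η, ℓ, δ / α, σ ^ 2 / (2 * α)) :=
      (contDiffAt_gaussianQuadIntegral hV).continuousAt
    exact hc.tendsto.comp (tendsto_const_nhds.prodMk_nhds (tendsto_const_nhds.prodMk_nhds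
      ((tendsto_ouMean hα δ ξ).prodMk_nhds (tendsto_ouVariance hα σ))))
  · refine exists_forall_abs_deriv_le hK hF
      (c := fun (T : ℝ≥0) η' => (η', ℓ, ouMean δ α ξ T, ouVariance α σ T))
      (fun T => ?_) (fun T => (hasDerivAt_id η).prodMk (hasDerivAt_const _ _)) hmem
      (fun T => le_rfl)
    -- The closed form is available only under the strict bound on `η'`, an open condition, so it
    -- holds near `η`, which is enough for the derivative.
    filter_upwards [Iio_mem_nhds hη] with η' hη' using hrem ℓ δ hα hη' T
  · refine exists_forall_abs_deriv_le hK hF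
      (c := fun (T : ℝ≥0) ℓ' => (η, ℓ', ouMean δ α ξ T, ouVariance α σ T))
      (fun T => ?_) (fun T => (hasDerivAt_const _ _).prodMk
        ((hasDerivAt_id ℓ).prodMk (hasDerivAt_const _ _))) hmem (fun T => le_rfl)
    exact Eventually.of_forall fun ℓ' => hrem ℓ' δ hα hη T
  · refine exists_forall_abs_deriv_le hK hF
      (c := fun (T : ℝ≥0) α' => (η, ℓ, ouMean δ α' ξ T, ouVariance α' σ T))
      -- The product norm is the maximum norm: the two entries bound the `α`-derivatives of the mean
      -- and of the variance, with `T e^{-αT}` replaced by `1/α` and the remaining exponential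
      -- factors by `1`.
      (D := max (1 / α * |δ / α - ξ| + |δ / α ^ 2|)
        (σ ^ 2 / α * (1 / α) + σ ^ 2 / (2 * α ^ 2)))
      (fun T => ?_) (fun T => (hasDerivAt_const _ _).prodMk ((hasDerivAt_const _ _).prodMk
        ((hasDerivAt_ouMean_rate hα.ne' δ ξ T).prodMk (hasDerivAt_ouVariance_rate hα.ne' σ T))))
      hmem (fun T => ?_)
    · have hcont : ContinuousAt (fun α' : ℝ => 2 * α' / σ ^ 2) α := by fun_prop
      filter_upwards [Ioi_mem_nhds hα, hcont.eventually (Ioi_mem_nhds hη)] with α' hα' hη'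
        using hrem ℓ δ hα' hη' T
    · obtain ⟨h0, h1⟩ := hθ T
      have hb := abs_mul_exp_neg_mul_le hα T.coe_nonneg
      simp only [Prod.norm_mk, norm_zero, Real.norm_eq_abs]
      refine max_le (by positivity) (max_le (by positivity) (max_le_max ?_ ?_))
      · refine (abs_sub _ _).trans (add_le_add ?_ ?_)
        · rw [abs_mul]; gcongr
        · rw [abs_mul, abs_of_nonneg (sub_nonneg.2 h1)]
          exact mul_le_of_le_one_right (abs_nonneg _) (by linarith)
      · refine (abs_sub _ _).trans (add_le_add ?_ ?_)
        · rw [abs_mul, abs_mul, abs_of_pos h0, abs_of_nonneg (by positivity : 0 ≤ σ ^ 2 / α)]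
          refine (mul_le_of_le_one_right (by positivity) h1).trans ?_
          gcongr
        · rw [abs_of_nonneg (mul_nonneg (by positivity) (by nlinarith))]
          exact mul_le_of_le_one_right (by positivity) (by nlinarith)
  · refine exists_forall_abs_deriv_le hK hF
      (c := fun (T : ℝ≥0) δ' => (η, ℓ, ouMean δ' α ξ T, ouVariance α σ T)) (D := 1 / α)
      (fun T => ?_) (fun T => (hasDerivAt_const _ _).prodMk ((hasDerivAt_const _ _).prodMk
        ((hasDerivAt_ouMean_drift δ α ξ T).prodMk (hasDerivAt_const _ _)))) hmem (fun T => ?_)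
    · exact Eventually.of_forall fun δ' => hrem ℓ δ' hα hη T
    · obtain ⟨h0, h1⟩ := hθ T
      simp only [Prod.norm_mk, norm_zero, Real.norm_eq_abs]
      have : |(1 - Real.exp (-(α * T))) / α| ≤ 1 / α := by
        rw [abs_div, abs_of_nonneg (sub_nonneg.2 h1), abs_of_pos hα]
        gcongr
        linarith
      have hα1 : 0 ≤ 1 / α := by positivity
      exact max_le hα1 (max_le hα1 (max_le this hα1))
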